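/- There is a universal constant $c>0$ with the following property. Let $d\in\mathbb N$, let $\mathcal X\subset\mathbb R^d$ be a nonempty set of measurement vectors, let $\mathcal Z\subset\mathbb R^d$ be a set of items, and let $\delta\in(0,1/8)$. A non-interactive (oracle) MLE procedure fixes, for every parameter $\theta\in\mathbb R^d$, a finite sequence $x_1,\dots,x_{T}\in\mathcal X$, where both the number of samples $T=T(\theta)$ and the $x_t$ may depend on $\theta$. It observes independent $y_t\sim\mathcal N(\langle x_t,\theta\rangle,1)$, $1\le t\le T$, forms the maximum likelihood estimate $\widehat\theta\in\arg\min_{\theta'\in\mathbb R^d}\sum_{t=1}^{T}(y_t-\langle x_t,\theta'\rangle)^2$ and outputs $\widehat z=\arg\max_{z\in\mathcal Z}\langle z,\widehat\theta\rangle$. The output is $z$ if $\arg\max_{\mathcal Z}\langle\cdot,\widehat\theta\rangle=\{z\}$; if the minimizer $\widehat\theta$ is not unique, this is required for every minimizer. The procedure is $\delta$-PAC for $(\mathcal X,\mathcal Z,\mathbb R^d)$ if, for every $\theta\in\mathbb R^d$ for which $\arg\max_{z\in\mathcal Z}\langle z,\theta\rangle=\{z_*\}$ is a single point, it outputs $z_*$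 with probability at least $1-\delta$. Suppose that a non-interactive MLE procedure is $\delta$-PAC for $(\mathcal X,\mathcal Z,\mathbb R^d)$, and let $\theta\in\mathbb R^d$ be such that $\arg\max_{z\in\mathcal Z}\langle z,\theta\rangle=\{z_*\}$. Then the number of samples that it uses on the instance $(\mathcal X,\mathcal Z,\theta)$ satisfies $$T(\theta)\ \ge\ c\,\bigl(\gamma^*+\rho^*\log(1/\delta)\bigr).$$ Here, with $\lambda$ ranging over the finitely supported probability weights on $\mathcal X$ and $A(\lambda)=\sum_{x}\lambda_x xx^\top$, $$\rho^*=\inf_{\lambda}\ \sup_{z\in\mathcal Z\setminus\{z_*\}}\frac{\|z_*-z\|^2_{A(\lambda)^{-1}}}{\langle\theta,z_*-z\rangle^2},\qquad \gamma^*=\inf_{\lambda}\ \Bigl(\mathbb E_{\eta\sim\mathcal N(0,I_d)}\Bigl[\sup_{z\in\mathcal Z\setminus\{z_*\}}\frac{(z_*-z)^\top A(\lambda)^{-1/2}\eta}{\theta^\top(z_*-z)}\Bigr]\Bigr)^{2},$$ where $\|v\|^2_{A^{-1}}=v^\top A^{-1}v$. For singular $A(\lambda)$, the inverse and its square root are taken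 on the range of $A(\lambda)$, and the quantity under the infimum is $+\infty$ if some $z_*-z$, $z\in\mathcal Z$, does not lie in this range. If $\mathcal Z=\{z_*\}$, both quantities are $0$. -/

import Mathlib

open MeasureTheory ProbabilityTheory
open scoped ENNReal

noncomputable section

namespace TransductiveBandit

/-- `ℝ^d` with its Euclidean structure. -/
abbrev Vec (d : ℕ) : Type := EuclideanSpace ℝ (Fin d)

variable {d : ℕ}

/-- The set `argmax_{z ∈ Z} ⟨z, w⟩`. -/
def argmaxSet (Z : Set (Vec d)) (w : Vec d) : Set (Vec d) :=
  {z | z ∈ Z ∧ ∀ z' ∈ Z, inner ℝ z' w ≤ inner ℝ z w}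

/-! ### The non-interactive MLE procedure -/

/-- A fixed finite sequence of measurement vectors from `X`, chosen before any data is seen. -/
structure Allocation (X : Set (Vec d)) where
  /-- the number of samples -/
  n : ℕ
  /-- the measurement vectors, in order, repetitions allowed -/
  x : Fin n → Vec d
  mem : ∀ t, x t ∈ X

/-- The joint law of the independent observations `y_t ~ N(⟨x_t, θ⟩, 1)`. -/
def obsLaw {X : Set (Vec d)} (a : Allocation X) (θ : Vec d) : Measure (Fin a.n → ℝ) :=
  Measure.pi fun t => gaussianReal (inner ℝ (a.x t) θ) 1

/-- The maximum likelihood (least squares) estimates from the observations `y`. This is always a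
nonempty set; it is a single point exactly when the measurement vectors span `ℝ^d`. -/
def mleSet {X : Set (Vec d)} (a : Allocation X) (y : Fin a.n → ℝ) : Set (Vec d) :=
  {θhat | ∀ θ' : Vec d,
    ∑ t, (y t - inner ℝ (a.x t) θhat) ^ 2 ≤ ∑ t, (y t - inner ℝ (a.x t) θ') ^ 2}

/-- The event that the procedure outputs `zs`: under the maximum likelihood estimate, `zs` is the
only maximizer over `Z`. If the estimate is not unique, this is required of all estimates, so that
the output does not depend on which one is taken. -/
def outputEvent {X : Set (Vec d)} (a : Allocation X) (Z : Set (Vec d)) (zs : Vec d) :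
    Set (Fin a.n → ℝ) :=
  {y | ∀ θhat ∈ mleSet a y, argmaxSet Z θhat = {zs}}

/-- The non-interactive MLE that uses the allocation `alloc θ` when the parameter is `θ` is
`δ`-PAC for `(X, Z, Θ)`: for all `θ ∈ Θ` with a unique best item, it outputs this item with
probability at least `1 - δ`. -/
def IsPAC (δ : ℝ) (X Z Θ : Set (Vec d)) (alloc : Vec d → Allocation X) : Prop :=
  ∀ θ ∈ Θ, ∀ zs : Vec d, argmaxSet Z θ = {zs} →
    ENNReal.ofReal (1 - δ) ≤ obsLaw (alloc θ) θ (outputEvent (alloc θ) Z zs)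

/-! ### The quantities `ρ*` and `γ*` -/

/-- The simplex over `X`: finitely supported probability weights on `X`. -/
def designs (X : Set (Vec d)) : Set (Vec d →₀ ℝ) :=
  {w | (∀ x ∈ w.support, x ∈ X) ∧ (∀ x, 0 ≤ w x) ∧ (w.sum fun _ p => p) = 1}

/-- `A(λ) = ∑ₓ λₓ x xᵀ`. -/
def designMatrix (w : Vec d →₀ ℝ) : Matrix (Fin d) (Fin d) ℝ :=
  w.sum fun x p => p • Matrix.vecMulVec x.ofLp x.ofLp

/-- `A⁻¹` for positive semidefinite `A`, by functional calculus. For singular `A` it is the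
inverse on the range of `A` and zero on the kernel (as `0⁻¹ = 0`); it is used below only
on vectors in the range. -/
def psdInv (A : Matrix (Fin d) (Fin d) ℝ) : Matrix (Fin d) (Fin d) ℝ :=
  cfc (fun t : ℝ => t⁻¹) A

/-- `A^{-1/2}` for positive semidefinite `A`, with the same convention for singular `A`. -/
def psdInvSqrt (A : Matrix (Fin d) (Fin d) ℝ) : Matrix (Fin d) (Fin d) ℝ :=
  cfc (fun t : ℝ => (√t)⁻¹) A

open scoped Classical in
/-- `‖v‖²_{A⁻¹} = vᵀ A⁻¹ v`, which is `∞` if `v` is not in the range of `A`. -/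
def invNormSq (A : Matrix (Fin d) (Fin d) ℝ) (v : Vec d) : ℝ≥0∞ :=
  if v ∈ LinearMap.range (Matrix.toEuclideanLin A) then
    ENNReal.ofReal (inner ℝ v (Matrix.toEuclideanLin (psdInv A) v))
  else ⊤

/-- `ρ*(λ) = sup_{z ∈ Z \ {z*}} ‖z* - z‖²_{A(λ)⁻¹} / ⟨θ, z* - z⟩²`. -/
def rho (Z : Set (Vec d)) (θ zs : Vec d) (w : Vec d →₀ ℝ) : ℝ≥0∞ :=
  ⨆ z ∈ Z \ {zs},
    invNormSq (designMatrix w) (zs - z) / ENNReal.ofReal (inner ℝ θ (zs - z) ^ 2)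

/-- `ρ* = inf_λ ρ*(λ)`. -/
def rhoStar (X Z : Set (Vec d)) (θ zs : Vec d) : ℝ≥0∞ :=
  ⨅ w ∈ designs X, rho Z θ zs w

/-- `sup_{z ∈ Z \ {z*}} (z* - z)ᵀ A(λ)^{-1/2} η / θᵀ(z* - z)`, in `[-∞, ∞]`. -/
def gaussSup (Z : Set (Vec d)) (θ zs : Vec d) (w : Vec d →₀ ℝ) (η : Vec d) : EReal :=
  ⨆ z ∈ Z \ {zs},
    ((inner ℝ (zs - z) (Matrix.toEuclideanLin (psdInvSqrt (designMatrix w)) η)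
      / inner ℝ θ (zs - z) : ℝ) : EReal)

/-- `E_{η ~ N(0, I)}` of the previous supremum, as the integral of the positive part minus the
integral of the negative part. For `Z \ {z*}` nonempty the supremum is at least a centred
Gaussian variable, so the second integral is finite and the difference is in `[0, ∞]`. For
`Z = {z*}` the value is `0`. -/
def gaussWidth (Z : Set (Vec d)) (θ zs : Vec d) (w : Vec d →₀ ℝ) : ℝ≥0∞ :=
  (∫⁻ η, (gaussSup Z θ zs w η).toENNReal ∂(stdGaussian (Vec d)))
    - ∫⁻ η, (-gaussSup Z θ zs w η).toENNReal ∂(stdGaussian (Vec d))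

open scoped Classical in
/-- `γ*(λ)`, the square of the expected supremum; it is `∞` if `A(λ)` is singular and some
`z* - z` is not in its range. -/
def gamma (Z : Set (Vec d)) (θ zs : Vec d) (w : Vec d →₀ ℝ) : ℝ≥0∞ :=
  if ∀ z ∈ Z, zs - z ∈ LinearMap.range (Matrix.toEuclideanLin (designMatrix w)) then
    gaussWidth Z θ zs w ^ 2
  else ⊤

/-- `γ* = inf_λ γ*(λ)`. -/
def gammaStar (X Z : Set (Vec d)) (θ zs : Vec d) : ℝ≥0∞ :=
  ⨅ w ∈ designs X, gamma Z θ zs w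

end TransductiveBandit

end

/-! The guarantee at `θ` alone suffices. With `n` samples and empirical design matrix `A`, one least
squares estimate is `θ` plus an error of law `N(0, A⁻¹/n)`, where `A⁻¹` is the inverse on the range.
If the output is `zs`, this estimate ranks `zs` at least as high as every `z`. Dividing by the gap
`⟨θ, zs - z⟩ > 0`, the linear forms `⟨g_z, η⟩`, with `g_z = gapVec a θ zs z` and `η` standard
Gaussian, are thus all at least `-1` simultaneously with probability at least `1 - δ`
(`obsLaw_outputEvent_le`).

This is used twice. For a single `z`, the Gaussian lower tail forces `‖g_z‖² log (1/δ) ≤ 11`, which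
bounds the `ρ` term by `11 n`. For all `z` together, since `1 - δ ≥ 7/8`, symmetry and Fernique's
theorem bound the expected supremum of `|⟨g_z, η⟩|` by `5`, which bounds the `γ` term by `25 n`. The
empirical design competes in both infima; it is admissible because the estimate can single out `zs`
only if every `zs - z` lies in the range of `A` (`sub_mem_range_of_mem_outputEvent`). -/

noncomputable section

namespace TransductiveBandit

/-! ### Suprema of Gaussian processes -/

section GaussianProcess

variable {E : Type*} [NormedAddCommGroup E] [InnerProductSpace ℝ E] {ι : Type*}

/-- The symmetric convex set of points on which all the linear forms `⟪g i, ·⟫` are at most `t`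
in absolute value. -/
def slab (g : ι → E) (t : ℝ) : Set E := {η | ∀ i, |inner ℝ (g i) η| ≤ t}

lemma isClosed_slab (g : ι → E) (t : ℝ) : IsClosed (slab g t) := by
  simp only [slab, Set.ofPred_forall]
  exact isClosed_iInter fun i => isClosed_le (by fun_prop) continuous_const

/-- If `η` lies in the slab of width `t`, and `u` in that of width `1`, then `√2 η + u` lies in the
slab of width `(5/2) t`. -/
lemma sqrt_two_smul_add_mem_slab {g : ι → E} {t : ℝ} (ht : 1 ≤ t) {η u : E}
    (hη : η ∈ slab g t) (hu : u ∈ slab g 1) : √2 • η + u ∈ slab g (5 / 2 * t) := by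
  intro i
  have h2 : √2 ≤ 3 / 2 := by
    rw [Real.sqrt_le_left (by norm_num)]; norm_num
  rw [inner_add_right, inner_smul_right]
  calc |√2 * inner ℝ (g i) η + inner ℝ (g i) u|
      ≤ |√2 * inner ℝ (g i) η| + |inner ℝ (g i) u| := abs_add_le _ _
    _ ≤ 3 / 2 * t + 1 := by
      rw [abs_mul, abs_of_nonneg (Real.sqrt_nonneg 2)]
      exact add_le_add (mul_le_mul h2 (hη i) (abs_nonneg _) (by norm_num)) (hu i)
    _ ≤ 5 / 2 * t := by linarith

lemma neg_mem_slab {g : ι → E} {t : ℝ} {η : E} (hη : η ∈ slab g t) : -η ∈ slab g t := by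
  intro i
  simpa using hη i

lemma iSup_enorm_inner_le_iff (g : ι → E) (η : E) {t : ℝ} (ht : 0 ≤ t) :
    ⨆ i, ‖inner ℝ (g i) η‖ₑ ≤ ENNReal.ofReal t ↔ η ∈ slab g t := by
  simp only [iSup_le_iff, slab, Set.mem_ofPred_eq]
  refine forall_congr' fun i => ?_
  rw [← ofReal_norm, ENNReal.ofReal_le_ofReal_iff ht, Real.norm_eq_abs]

/-- Consider the first scale `(5/2)^k` whose slab contains `η`. If `k = 0`, the summand `1`
suffices; otherwise the term of index `k - 1` does. If no slab contains `η`, the terms are unbounded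
and the sum is infinite. -/
lemma iSup_enorm_inner_le_tsum (g : ι → E) (η : E) :
    ⨆ i, ‖inner ℝ (g i) η‖ₑ ≤ 1 + ∑' k : ℕ, (slab g ((5 / 2) ^ k))ᶜ.indicator
      (fun _ => ENNReal.ofReal ((5 / 2) ^ (k + 1))) η := by
  classical
  set S := ∑' k : ℕ, (slab g ((5 / 2) ^ k))ᶜ.indicator
      (fun _ => ENNReal.ofReal ((5 / 2) ^ (k + 1))) η with hS
  have hle : ∀ k, η ∉ slab g ((5 / 2) ^ k) → ENNReal.ofReal ((5 / 2) ^ (k + 1)) ≤ S := by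
    intro k hk
    refine le_trans ?_ (ENNReal.le_tsum k)
    rw [Set.indicator_of_mem (by exact hk)]
  by_cases hex : ∃ k : ℕ, η ∈ slab g ((5 / 2) ^ k)
  · have hmem := Nat.find_spec hex
    rw [← iSup_enorm_inner_le_iff g η (by positivity)] at hmem
    rcases hk : Nat.find hex with _ | m
    · rw [hk] at hmem
      exact hmem.trans (by simp)
    · have hm := Nat.find_min hex (m := m) (by omega)
      rw [hk] at hmem
      exact hmem.trans ((hle m hm).trans le_add_self)
  · push Not at hex
    have : S = ⊤ := by
      refine ENNReal.eq_top_of_forall_nnreal_le fun r => ?_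
      obtain ⟨k, hk⟩ := pow_unbounded_of_one_lt (r : ℝ) (show (1 : ℝ) < 5 / 2 by norm_num)
      refine le_trans ?_ (hle k (hex k))
      rw [← ENNReal.ofReal_coe_nnreal]
      refine ENNReal.ofReal_le_ofReal (hk.le.trans ?_)
      exact pow_le_pow_right₀ (by norm_num) (Nat.le_succ k)
    simp [this]

variable [FiniteDimensional ℝ E] [MeasurableSpace E] [BorelSpace E]

/-- Fernique's rotation trick: for independent `p₁, p₂`, the pair `(p₁ - p₂)/√2, (p₁ + p₂)/√2` has
the same joint law. If the first is in the unit slab and the second outside the wide one, neither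
`p₁` nor `p₂` can be in the slab of width `t`, since `(p₁ + p₂)/√2 = √2 p₁ - (p₁ - p₂)/√2 = √2 p₂ +
(p₁ - p₂)/√2`. -/
lemma measure_slab_mul_measure_compl_le (g : ι → E) {t : ℝ} (ht : 1 ≤ t) :
    stdGaussian E (slab g 1) * stdGaussian E (slab g (5 / 2 * t))ᶜ
      ≤ stdGaussian E (slab g t)ᶜ ^ 2 := by
  set μ := stdGaussian E
  have hrot : (μ.prod μ).map (ContinuousLinearMap.rotation (-(Real.pi / 4))) = μ.prod μ :=
    IsGaussian.map_rotation_eq_self (by simp [μ]) _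
  rw [← Measure.prod_prod, sq, ← Measure.prod_prod, ← hrot,
    Measure.map_apply (by fun_prop) ((isClosed_slab g _).measurableSet.prod
      (isClosed_slab g _).measurableSet.compl), hrot]
  refine measure_mono fun p hp => ?_
  rw [Set.mem_preimage, ContinuousLinearMap.rotation_apply] at hp
  obtain ⟨h1, h2⟩ := hp
  simp only [Real.cos_neg, Real.sin_neg, Real.cos_pi_div_four, Real.sin_pi_div_four] at h1 h2
  have hs : √2 = √2 / 2 + √2 / 2 := by ring
  refine ⟨fun h => h2 ?_, fun h => h2 ?_⟩
  · convert sqrt_two_smul_add_mem_slab ht h (neg_mem_slab h1) using 1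
    nth_rewrite 3 [hs]
    module
  · convert sqrt_two_smul_add_mem_slab ht h h1 using 1
    nth_rewrite 3 [hs]
    module

lemma measure_compl_slab_le (g : ι → E) (h : 3 / 4 ≤ stdGaussian E (slab g 1)) (k : ℕ) :
    stdGaussian E (slab g ((5 / 2) ^ k))ᶜ ≤ 4⁻¹ * 3⁻¹ ^ k := by
  induction k with
  | zero =>
    rw [pow_zero, pow_zero, mul_one, prob_compl_eq_one_sub (isClosed_slab g _).measurableSet]
    refine (tsub_le_tsub_left h 1).trans ?_
    rw [tsub_le_iff_right, ← ENNReal.toReal_le_toReal (by simp) (by finiteness)]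
    rw [ENNReal.toReal_add (by finiteness) (by finiteness)]
    norm_num
  | succ k ih =>
    have ht : (1 : ℝ) ≤ (5 / 2) ^ k := one_le_pow₀ (by norm_num)
    have h1 := measure_slab_mul_measure_compl_le g ht
    rw [← pow_succ'] at h1
    set p := stdGaussian E (slab g ((5 / 2) ^ (k + 1)))ᶜ
    -- One factor of the square is only bounded by `1/4`. The resulting ratio `1/3` per scale is
    -- enough, because `(5/2) * (1/3) < 1`.
    have h2 : 3 / 4 * p ≤ 4⁻¹ * (4⁻¹ * 3⁻¹ ^ k) := by
      refine (mul_le_mul_left h p).trans (h1.trans ?_)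
      rw [sq]
      refine mul_le_mul' (ih.trans ?_) ih
      exact mul_le_of_le_one_right' (pow_le_one' (by simp) _)
    have h3 : p = 4 / 3 * (3 / 4 * p) := by
      rw [← mul_assoc]
      have : (4 / 3 * (3 / 4) : ℝ≥0∞) = 1 := by
        rw [← ENNReal.toReal_eq_one_iff]; norm_num
      rw [this, one_mul]
    rw [h3]
    refine (mul_le_mul_right h2 _).trans (le_of_eq ?_)
    have : (4 / 3 * 4⁻¹ : ℝ≥0∞) = 3⁻¹ := by
      rw [← ENNReal.toReal_eq_toReal_iff' (by finiteness) (by finiteness)]; norm_num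
    rw [← mul_assoc, this, pow_succ']
    ring

/-- A quantitative form of the theorem of Fernique: if a Gaussian process is bounded by `1` in absolute
value with probability at least `3/4`, then its expected supremum is bounded by a universal
constant. -/
theorem lintegral_iSup_enorm_inner_le (g : ι → E) (h : 3 / 4 ≤ stdGaussian E (slab g 1)) :
    ∫⁻ η, ⨆ i, ‖inner ℝ (g i) η‖ₑ ∂(stdGaussian E) ≤ 5 := by
  have hmeas (k : ℕ) : MeasurableSet (slab g ((5 / 2) ^ k))ᶜ :=
    (isClosed_slab g _).measurableSet.compl
  calc ∫⁻ η, ⨆ i, ‖inner ℝ (g i) η‖ₑ ∂(stdGaussian E)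
      ≤ ∫⁻ η, (1 + ∑' k : ℕ, (slab g ((5 / 2) ^ k))ᶜ.indicator
          (fun _ => ENNReal.ofReal ((5 / 2) ^ (k + 1))) η) ∂(stdGaussian E) :=
        lintegral_mono fun η => iSup_enorm_inner_le_tsum g η
    _ = 1 + ∑' k : ℕ, ENNReal.ofReal ((5 / 2) ^ (k + 1))
          * stdGaussian E (slab g ((5 / 2) ^ k))ᶜ := by
        rw [lintegral_add_left measurable_const, lintegral_tsum
          fun k => (measurable_const.indicator (hmeas k)).aemeasurable]
        simp only [lintegral_const, measure_univ, mul_one, lintegral_indicator_const (hmeas _)]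
    _ ≤ 1 + ∑' k : ℕ, ENNReal.ofReal (5 / 8 * (5 / 6) ^ k) := by
        gcongr with k
        refine (mul_le_mul_right (measure_compl_slab_le g h k) _).trans (le_of_eq ?_)
        rw [← ENNReal.toReal_eq_toReal_iff' (by finiteness) (by finiteness)]
        rw [ENNReal.toReal_ofReal (by positivity), ENNReal.toReal_mul,
          ENNReal.toReal_ofReal (by positivity), ENNReal.toReal_mul, ENNReal.toReal_pow]
        simp only [ENNReal.toReal_inv, ENNReal.toReal_ofNat]
        rw [pow_succ, show (5 / 6 : ℝ) = 5 / 2 * 3⁻¹ by norm_num, mul_pow]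
        ring
    -- The sum is `1 + (5/8) * 6 = 19/4`.
    _ ≤ 5 := by
        have hs : Summable fun k : ℕ => (5 / 8 : ℝ) * (5 / 6) ^ k :=
          (summable_geometric_of_lt_one (by norm_num) (by norm_num)).mul_left _
        rw [← ENNReal.ofReal_tsum_of_nonneg (fun k => by positivity) hs, tsum_mul_left,
          tsum_geometric_of_lt_one (by norm_num) (by norm_num), ← ENNReal.ofReal_one,
          ← ENNReal.ofReal_add (by norm_num) (by norm_num),
          show (5 : ℝ≥0∞) = ENNReal.ofReal 5 by simp]
        exact ENNReal.ofReal_le_ofReal (by norm_num)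

lemma map_inner_stdGaussian (g : E) :
    (stdGaussian E).map (fun η => inner ℝ g η) = gaussianReal 0 (‖g‖ ^ 2).toNNReal := by
  have := IsGaussian.map_eq_gaussianReal (μ := stdGaussian E) (innerSL ℝ g)
  rw [integral_strongDual_stdGaussian, variance_dual_stdGaussian, innerSL_apply_norm] at this
  exact this

lemma map_neg_stdGaussian : (stdGaussian E).map (fun η => -η) = stdGaussian E :=
  stdGaussian_map (LinearIsometryEquiv.neg ℝ)

/-- A one-sided bound on a Gaussian process gives a two-sided one, by symmetry. -/
lemma measure_slab_ge_of_one_sided (g : ι → E)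
    (h : 7 / 8 ≤ stdGaussian E {η | ∀ i, -1 ≤ inner ℝ (g i) η}) :
    3 / 4 ≤ stdGaussian E (slab g 1) := by
  set μ := stdGaussian E
  set F := {η | ∀ i, -1 ≤ inner ℝ (g i) η} with hF
  have hFc : IsClosed F := by
    simp only [hF, Set.ofPred_forall]
    exact isClosed_iInter fun i => isClosed_le continuous_const (by fun_prop)
  set G := {η | ∀ i, inner ℝ (g i) η ≤ 1} with hG
  have hGc : IsClosed G := by
    simp only [hG, Set.ofPred_forall]
    exact isClosed_iInter fun i => isClosed_le (by fun_prop) continuous_const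
  have hGF : μ G = μ F := by
    have hneg : μ F = μ.map (fun η => -η) F := by rw [map_neg_stdGaussian]
    rw [hneg, Measure.map_apply measurable_neg hFc.measurableSet]
    congr 1
    ext η
    simp [hF, hG]
  have hslab : slab g 1 = (Fᶜ ∪ Gᶜ)ᶜ := by
    ext η
    simp only [slab, abs_le, Set.compl_union, compl_compl, hF, hG, Set.mem_inter_iff,
      Set.mem_ofPred_eq, forall_and]
  have hcompl : ∀ {A : Set E}, IsClosed A → 7 / 8 ≤ μ A → μ Aᶜ ≤ 8⁻¹ := by
    intro A hA hle
    rw [prob_compl_eq_one_sub hA.measurableSet]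
    refine (tsub_le_tsub_left hle 1).trans ?_
    rw [tsub_le_iff_right, ← ENNReal.toReal_le_toReal (by simp) (by finiteness)]
    rw [ENNReal.toReal_add (by finiteness) (by finiteness)]
    norm_num
  rw [hslab, prob_compl_eq_one_sub
    (hFc.measurableSet.compl.union hGc.measurableSet.compl)]
  refine le_trans ?_ (tsub_le_tsub_left ((measure_union_le _ _).trans
    (add_le_add (hcompl hFc h) (hcompl hGc (hGF ▸ h)))) 1)
  refine ENNReal.le_sub_of_add_le_right (by finiteness) ?_
  rw [← ENNReal.toReal_le_toReal (by finiteness) (by simp)]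
  rw [ENNReal.toReal_add (by finiteness) (by finiteness)]
  norm_num [ENNReal.toReal_add]

end GaussianProcess

/-! ### The lower tail bound for a Gaussian variable -/

/-- On `(u, u + 1]` the density is at least its value at the right end, and `1/√(2π) ≥ e⁻¹`. -/
lemma gaussianReal_Ioi_ge {u : ℝ} (hu : 0 ≤ u) :
    ENNReal.ofReal (Real.exp (-((u + 1) ^ 2 / 2) - 1)) ≤ gaussianReal 0 1 (Set.Ioi u) := by
  have hpi : √(2 * Real.pi) ≤ Real.exp 1 := by
    rw [Real.sqrt_le_left (Real.exp_pos _).le]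
    have h1 := Real.exp_one_gt_d9
    have h2 := Real.pi_lt_d2
    nlinarith
  have hint : IntegrableOn (gaussianPDFReal 0 1) (Set.Ioc u (u + 1)) :=
    (integrable_gaussianPDFReal 0 1).integrableOn
  calc ENNReal.ofReal (Real.exp (-((u + 1) ^ 2 / 2) - 1))
      ≤ ENNReal.ofReal (∫ x in Set.Ioc u (u + 1), gaussianPDFReal 0 1 x) := by
        refine ENNReal.ofReal_le_ofReal ?_
        have : ∫ x in Set.Ioc u (u + 1), Real.exp (-((u + 1) ^ 2 / 2) - 1)
            = Real.exp (-((u + 1) ^ 2 / 2) - 1) := by simp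
        rw [← this]
        refine setIntegral_mono_on (integrableOn_const (by simp)) hint measurableSet_Ioc ?_
        intro x hx
        rw [gaussianPDFReal, sub_eq_add_neg, Real.exp_add, mul_comm]
        refine mul_le_mul ?_ ?_ (Real.exp_pos _).le (by positivity)
        · rw [Real.exp_neg]
          refine inv_anti₀ (by positivity) ?_
          simpa using hpi
        · refine Real.exp_le_exp.2 ?_
          have h0 : 0 ≤ x := hu.trans hx.1.le
          have : x ^ 2 ≤ (u + 1) ^ 2 := by gcongr; exact hx.2
          simp only [sub_zero, NNReal.coe_one, mul_one]
          linarith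
    _ = gaussianReal 0 1 (Set.Ioc u (u + 1)) :=
        (gaussianReal_apply_eq_integral 0 one_ne_zero _).symm
    _ ≤ gaussianReal 0 1 (Set.Ioi u) := measure_mono Set.Ioc_subset_Ioi_self

lemma log_one_div_le_of_gaussianReal_Ioi_le {u δ : ℝ} (hu : 0 ≤ u) (hδ : 0 < δ) (hδ' : δ < 1 / 8)
    (h : gaussianReal 0 1 (Set.Ioi u) ≤ ENNReal.ofReal δ) :
    Real.log (1 / δ) ≤ 11 * u ^ 2 := by
  have h1 : Real.exp (-((u + 1) ^ 2 / 2) - 1) ≤ δ :=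
    (ENNReal.ofReal_le_ofReal_iff hδ.le).1 ((gaussianReal_Ioi_ge hu).trans h)
  have h2 : -((u + 1) ^ 2 / 2) - 1 ≤ Real.log δ := (Real.le_log_iff_exp_le hδ).2 h1
  have h3 : Real.log δ ≤ -(3 * Real.log 2) := by
    rw [← Real.log_rpow (by norm_num), ← Real.log_inv]
    refine Real.log_le_log hδ ?_
    norm_num
    linarith
  have h4 := Real.log_two_gt_d9
  rw [one_div, Real.log_inv]
  -- Since `log (1/δ) ≥ 3 log 2`, the tail bound keeps `u` away from `0`, so the additive constants
  -- can be absorbed into `11 u²`.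
  have h5 : (46 / 100 : ℝ) ≤ u := by nlinarith
  nlinarith [sq_nonneg (u - 1)]

/-- If a centred Gaussian variable exceeds `-1` with probability at least `1 - δ`, then its
variance is at most of order `1 / log (1/δ)`. -/
lemma norm_sq_mul_log_le {E : Type*} [NormedAddCommGroup E] [InnerProductSpace ℝ E]
    [FiniteDimensional ℝ E] [MeasurableSpace E] [BorelSpace E] (g : E) {δ : ℝ} (hδ : 0 < δ)
    (hδ' : δ < 1 / 8)
    (h : ENNReal.ofReal (1 - δ) ≤ stdGaussian E {η | -1 ≤ inner ℝ g η}) :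
    ‖g‖ ^ 2 * Real.log (1 / δ) ≤ 11 := by
  rcases eq_or_ne g 0 with rfl | hg
  · simp
  have hg' : 0 < ‖g‖ := norm_pos_iff.2 hg
  -- The failure event `⟨g, η⟩ < -1` becomes the upper tail beyond `‖g‖⁻¹` of the standard normal
  -- variable `⟨v, η⟩`.
  set v := -(‖g‖⁻¹ • g) with hv
  have hvn : ‖v‖ = 1 := by
    rw [hv, norm_neg, norm_smul, norm_inv, norm_norm, inv_mul_cancel₀ hg'.ne']
  have hmap := map_inner_stdGaussian v
  rw [hvn] at hmap
  simp only [one_pow, Real.toNNReal_one] at hmap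
  have hset : (fun η => inner ℝ v η) ⁻¹' Set.Ioi ‖g‖⁻¹ = {η | -1 ≤ inner ℝ g η}ᶜ := by
    ext η
    simp only [Set.mem_preimage, Set.mem_Ioi, Set.mem_compl_iff, Set.mem_ofPred_eq, not_le, hv,
      inner_neg_left, real_inner_smul_left]
    rw [lt_neg, ← mul_neg_one ‖g‖⁻¹, mul_lt_mul_iff_right₀ (inv_pos.2 hg')]
  have htail : gaussianReal 0 1 (Set.Ioi ‖g‖⁻¹) ≤ ENNReal.ofReal δ := by
    rw [← hmap, Measure.map_apply (by fun_prop) measurableSet_Ioi, hset,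
      prob_compl_eq_one_sub (isClosed_le continuous_const (by fun_prop)).measurableSet]
    refine (tsub_le_tsub_left h 1).trans ?_
    rw [← ENNReal.ofReal_one, ← ENNReal.ofReal_sub _ (by linarith)]
    simp
  have := log_one_div_le_of_gaussianReal_Ioi_le (inv_nonneg.2 hg'.le) hδ hδ' htail
  calc ‖g‖ ^ 2 * Real.log (1 / δ) ≤ ‖g‖ ^ 2 * (11 * ‖g‖⁻¹ ^ 2) := by gcongr
    _ = 11 := by field_simp

variable {d : ℕ}

local notation "opOf" => Matrix.toEuclideanCLM (n := Fin _) (𝕜 := ℝ)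

/-! ### Inverses of positive semidefinite matrices -/

section PsdInv

variable {A : Matrix (Fin d) (Fin d) ℝ}

lemma isSelfAdjoint_psdInv (A : Matrix (Fin d) (Fin d) ℝ) : IsSelfAdjoint (psdInv A) :=
  cfc_predicate _ _

lemma isSelfAdjoint_psdInvSqrt (A : Matrix (Fin d) (Fin d) ℝ) : IsSelfAdjoint (psdInvSqrt A) :=
  cfc_predicate _ _

lemma psdInvSqrt_mul_self (hA : A.PosSemidef) : psdInvSqrt A * psdInvSqrt A = psdInv A := by
  have hc (f : ℝ → ℝ) : ContinuousOn f (spectrum ℝ A) := A.finite_real_spectrum.continuousOn f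
  rw [psdInvSqrt, psdInv, ← cfc_mul _ _ A (hc _) (hc _)]
  refine cfc_congr fun t ht => ?_
  have ht0 : 0 ≤ t := (Matrix.posSemidef_iff_isHermitian_and_spectrum_nonneg.1 hA).2 ht
  rw [← mul_inv, Real.mul_self_sqrt ht0]

/-- The identity `t * t * t⁻¹ = t` also holds at `t = 0`, so no invertibility is needed. It shows
that `v - A A⁻¹ v` is in the kernel of `A`. -/
lemma mul_self_mul_psdInv (hA : A.PosSemidef) : A * A * psdInv A = A := by
  have hc (f : ℝ → ℝ) : ContinuousOn f (spectrum ℝ A) := A.finite_real_spectrum.continuousOn f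
  have hsa : IsSelfAdjoint A := hA.1
  have hid : cfc (fun t : ℝ => t) A = A := cfc_id' ℝ A hsa
  calc A * A * psdInv A
      = cfc (fun t : ℝ => t) A * cfc (fun t : ℝ => t) A * cfc (fun t : ℝ => t⁻¹) A := by
        rw [hid, psdInv]
    _ = cfc (fun t : ℝ => t * t * t⁻¹) A := by
        rw [← cfc_mul _ _ A (hc _) (hc _), ← cfc_mul _ _ A (hc _) (hc _)]
    _ = cfc (fun t : ℝ => t) A := cfc_congr fun t _ => mul_self_mul_inv t
    _ = A := hid

lemma psdInv_mul_mul_psdInv (hA : A.PosSemidef) : psdInv A * A * psdInv A = psdInv A := by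
  have hc (f : ℝ → ℝ) : ContinuousOn f (spectrum ℝ A) := A.finite_real_spectrum.continuousOn f
  have hsa : IsSelfAdjoint A := hA.1
  have hid : cfc (fun t : ℝ => t) A = A := cfc_id' ℝ A hsa
  calc psdInv A * A * psdInv A
      = cfc (fun t : ℝ => t⁻¹) A * cfc (fun t : ℝ => t) A * cfc (fun t : ℝ => t⁻¹) A := by
        rw [hid, psdInv]
    _ = cfc (fun t : ℝ => t⁻¹ * t * t⁻¹) A := by
        rw [← cfc_mul _ _ A (hc _) (hc _), ← cfc_mul _ _ A (hc _) (hc _)]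
    _ = psdInv A := cfc_congr fun t _ => by
        rcases eq_or_ne t 0 with rfl | h
        · simp
        · simp [h]

lemma inner_toEuclideanCLM_comm {M : Matrix (Fin d) (Fin d) ℝ} (hM : IsSelfAdjoint M)
    (u v : Vec d) :
    inner ℝ (opOf M u) v = inner ℝ u (opOf M v) := by
  have h : IsSelfAdjoint (opOf M) := hM.map _
  rw [← ContinuousLinearMap.adjoint_inner_right, h.adjoint_eq]

lemma norm_psdInvSqrt_sq (hA : A.PosSemidef) (v : Vec d) :
    ‖opOf (psdInvSqrt A) v‖ ^ 2
      = inner ℝ v (opOf (psdInv A) v) := by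
  rw [← real_inner_self_eq_norm_sq, inner_toEuclideanCLM_comm (isSelfAdjoint_psdInvSqrt _),
    ← mul_apply_eq_comp, ← map_mul, psdInvSqrt_mul_self hA]

end PsdInv

/-! ### The empirical design of an allocation -/

section Allocation

variable {X : Set (Vec d)}

/-- The map `θ ↦ (⟨x_t, θ⟩)_t`. -/
def measMap (a : Allocation X) : Vec d →L[ℝ] EuclideanSpace ℝ (Fin a.n) :=
  LinearMap.toContinuousLinearMap
    { toFun := fun θ => WithLp.toLp 2 fun t => inner ℝ (a.x t) θ
      map_add' := fun u v => by ext t; simp [inner_add_right]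
      map_smul' := fun c u => by ext t; simp [inner_smul_right] }

@[simp]
lemma measMap_apply (a : Allocation X) (θ : Vec d) (t : Fin a.n) :
    measMap a θ t = inner ℝ (a.x t) θ := rfl

/-- The design that gives each of the measurements of `a` the same weight. -/
def empirical (a : Allocation X) : Vec d →₀ ℝ :=
  ∑ t, Finsupp.single (a.x t) (a.n : ℝ)⁻¹

lemma empirical_mem_designs (a : Allocation X) (hn : a.n ≠ 0) : empirical a ∈ designs X := by
  classical
  refine ⟨fun x hx => ?_, fun x => ?_, ?_⟩
  · obtain ⟨t, -, ht⟩ := Finset.mem_biUnion.1 (Finsupp.support_finsetSum hx)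
    have := Finsupp.support_single_subset ht
    rw [Finset.mem_singleton] at this
    exact this ▸ a.mem t
  · rw [empirical, Finsupp.finsetSum_apply]
    refine Finset.sum_nonneg fun t _ => ?_
    rw [Finsupp.single_apply]
    split_ifs <;> positivity
  · rw [empirical, ← Finsupp.sum_finsetSum_index (fun _ => rfl) (fun _ _ _ => rfl)]
    simp [hn]

lemma designMatrix_empirical (a : Allocation X) :
    designMatrix (empirical a)
      = ∑ t, (a.n : ℝ)⁻¹ • Matrix.vecMulVec (a.x t).ofLp (a.x t).ofLp := by
  rw [designMatrix, empirical, ← Finsupp.sum_finsetSum_index (fun _ => by simp)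
    (fun _ _ _ => add_smul _ _ _)]
  simp

lemma posSemidef_designMatrix_empirical (a : Allocation X) :
    (designMatrix (empirical a)).PosSemidef := by
  rw [designMatrix_empirical]
  refine Matrix.posSemidef_sum _ fun t _ => Matrix.PosSemidef.smul ?_ (by positivity)
  simpa using Matrix.posSemidef_vecMulVec_self_star (a.x t).ofLp

/-- The Gram operator of the measurements is `n` times the design matrix; this links least squares
to the design. -/
lemma adjoint_measMap_measMap (a : Allocation X) (hn : a.n ≠ 0) (v : Vec d) :
    (measMap a).adjoint (measMap a v)
      = (a.n : ℝ) • opOf (designMatrix (empirical a)) v := by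
  refine ext_inner_left ℝ fun u => ?_
  rw [ContinuousLinearMap.adjoint_inner_right, inner_smul_right, Matrix.inner_toEuclideanCLM,
    designMatrix_empirical, Matrix.sum_mulVec, dotProduct_sum, Finset.mul_sum, PiLp.inner_apply]
  refine Finset.sum_congr rfl fun t _ => ?_
  have hn' : (a.n : ℝ) ≠ 0 := by exact_mod_cast hn
  rw [Matrix.smul_mulVec, dotProduct_smul, Matrix.vecMulVec_mulVec, measMap_apply, measMap_apply]
  simp only [EuclideanSpace.inner_eq_star_dotProduct, star_trivial, dotProduct_smul,
    RCLike.inner_apply, conj_trivial, smul_eq_mul, op_smul_eq_smul]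
  rw [dotProduct_comm v.ofLp]
  field_simp

lemma measMap_eq_zero_of_designMatrix (a : Allocation X) (hn : a.n ≠ 0) {v : Vec d}
    (h : opOf (designMatrix (empirical a)) v = 0) : measMap a v = 0 := by
  rw [← inner_self_eq_zero (𝕜 := ℝ), ← ContinuousLinearMap.adjoint_inner_right,
    adjoint_measMap_measMap a hn, h, smul_zero, inner_zero_right]

lemma sum_sq_eq_norm_sq (a : Allocation X) (y : Fin a.n → ℝ) (θ : Vec d) :
    ∑ t, (y t - inner ℝ (a.x t) θ) ^ 2 = ‖WithLp.toLp 2 y - measMap a θ‖ ^ 2 := by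
  simp [EuclideanSpace.norm_sq_eq]

/-- The normal equations. -/
lemma mem_mleSet_of_adjoint_eq_zero (a : Allocation X) (y : Fin a.n → ℝ) (θhat : Vec d)
    (h : (measMap a).adjoint (WithLp.toLp 2 y - measMap a θhat) = 0) : θhat ∈ mleSet a y := by
  intro θ'
  rw [sum_sq_eq_norm_sq, sum_sq_eq_norm_sq]
  have h1 : WithLp.toLp 2 y - measMap a θ'
      = (WithLp.toLp 2 y - measMap a θhat) + measMap a (θhat - θ') := by
    rw [map_sub]; abel
  have h2 : inner ℝ (WithLp.toLp 2 y - measMap a θhat) (measMap a (θhat - θ')) = 0 := by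
    rw [← ContinuousLinearMap.adjoint_inner_left, h, inner_zero_left]
  rw [h1, norm_add_sq_real, h2]
  nlinarith [sq_nonneg ‖measMap a (θhat - θ')‖]

lemma add_mem_mleSet (a : Allocation X) {y : Fin a.n → ℝ} {θhat k : Vec d}
    (hθ : θhat ∈ mleSet a y) (hk : measMap a k = 0) : θhat + k ∈ mleSet a y := by
  intro θ'
  have := hθ θ'
  rw [sum_sq_eq_norm_sq] at this ⊢
  rwa [map_add, hk, add_zero]

/-- The error `(1/n) A⁻¹ ∑ₜ εₜ xₜ` of the least squares estimate as a function of the noise. -/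
def errorMap (a : Allocation X) : EuclideanSpace ℝ (Fin a.n) →L[ℝ] Vec d :=
  (a.n : ℝ)⁻¹ • opOf (psdInv (designMatrix (empirical a)))
    ∘L (measMap a).adjoint

lemma designMatrix_sub_eq_zero (a : Allocation X) (v : Vec d) :
    opOf (designMatrix (empirical a))
      (v - opOf (designMatrix (empirical a))
        (opOf (psdInv (designMatrix (empirical a))) v)) = 0 := by
  have h := mul_self_mul_psdInv (posSemidef_designMatrix_empirical a)
  rw [map_sub, ← mul_apply_eq_comp, ← mul_apply_eq_comp, ← map_mul,
    ← map_mul, h, sub_self]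

lemma add_errorMap_mem_mleSet (a : Allocation X) (hn : a.n ≠ 0) (θ : Vec d)
    (ε : EuclideanSpace ℝ (Fin a.n)) :
    θ + errorMap a ε ∈ mleSet a (measMap a θ + ε).ofLp := by
  have hn' : (a.n : ℝ) ≠ 0 := by exact_mod_cast hn
  refine mem_mleSet_of_adjoint_eq_zero a _ _ ?_
  rw [WithLp.toLp_ofLp, map_add, add_sub_add_left_eq_sub]
  have h1 : (measMap a).adjoint (ε - measMap a (errorMap a ε))
      = (measMap a).adjoint ε - opOf (designMatrix (empirical a))
        (opOf (psdInv (designMatrix (empirical a)))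
          ((measMap a).adjoint ε)) := by
    rw [map_sub, adjoint_measMap_measMap a hn, errorMap]
    simp [hn']
  -- With `M` the measurement map and `r` the residual, `M* r` lies in `ker A`, which is contained
  -- in `ker M`; hence `‖M* r‖² = ⟨r, M M* r⟩ = 0`.
  have h2 := measMap_eq_zero_of_designMatrix a hn
    (designMatrix_sub_eq_zero a ((measMap a).adjoint ε))
  rw [← h1] at h2
  rw [← inner_self_eq_zero (𝕜 := ℝ), ContinuousLinearMap.adjoint_inner_left, h2, inner_zero_right]

/-- If the procedure may output `zs`, then all differences `zs - z` can be estimated. -/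
lemma sub_mem_range_of_mem_outputEvent (a : Allocation X) (hn : a.n ≠ 0) {Z : Set (Vec d)}
    {zs : Vec d} {y : Fin a.n → ℝ} (hy : y ∈ outputEvent a Z zs) {z : Vec d} (hz : z ∈ Z) :
    zs - z ∈ LinearMap.range (Matrix.toEuclideanLin (designMatrix (empirical a))) := by
  by_contra hv
  set B := opOf (designMatrix (empirical a))
  set P := opOf (psdInv (designMatrix (empirical a)))
  set v := zs - z with hvdef
  -- `k` is the component of `v` in the kernel of `A`, nonzero as `v` is not in the range.
  set k := v - B (P v) with hkdef
  have hBk : B k = 0 := designMatrix_sub_eq_zero a v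
  have hk0 : k ≠ 0 := fun h => hv ⟨P v, (sub_eq_zero.1 h).symm⟩
  have hvk : inner ℝ v k = ‖k‖ ^ 2 := by
    have h1 : inner ℝ (B (P v)) k = 0 := by
      rw [inner_toEuclideanCLM_comm (posSemidef_designMatrix_empirical a).1, hBk,
        inner_zero_right]
    rw [← real_inner_self_eq_norm_sq, ← sub_eq_zero, ← inner_sub_left, hkdef, sub_sub_cancel]
    exact h1
  obtain ⟨θ₀, hθ₀⟩ : ∃ θ₀, θ₀ ∈ mleSet a y :=
    ⟨_, by simpa using add_errorMap_mem_mleSet a hn 0 (WithLp.toLp 2 y)⟩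
  -- The data do not see the direction `k`, so the estimate may be moved along it until `zs` and `z`
  -- tie, contradicting uniqueness of the maximizer.
  set θ₁ := θ₀ + (-(inner ℝ v θ₀ / ‖k‖ ^ 2)) • k with hθ₁
  have hmem : θ₁ ∈ mleSet a y := add_mem_mleSet a hθ₀ (by
    rw [map_smul, measMap_eq_zero_of_designMatrix a hn hBk, smul_zero])
  have htie : inner ℝ v θ₁ = 0 := by
    have : ‖k‖ ^ 2 ≠ 0 := by simpa using hk0
    rw [hθ₁, inner_add_right, inner_smul_right, hvk]
    field_simp
    ring
  have harg := hy θ₁ hmem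
  have hzs : zs ∈ argmaxSet Z θ₁ := harg ▸ rfl
  have hzarg : z ∈ argmaxSet Z θ₁ := by
    rw [hvdef, inner_sub_left, sub_eq_zero] at htie
    exact ⟨hz, fun z' hz' => htie ▸ hzs.2 z' hz'⟩
  rw [harg] at hzarg
  refine hv ?_
  rw [hvdef, Set.mem_singleton_iff.1 hzarg, sub_self]
  exact zero_mem _

/-! ### The law of the estimate -/

lemma obsLaw_eq_map (a : Allocation X) (θ : Vec d) :
    obsLaw a θ = (stdGaussian (EuclideanSpace ℝ (Fin a.n))).map
      fun ε => (measMap a θ + ε).ofLp := by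
  rw [← map_pi_eq_stdGaussian, Measure.map_map (by fun_prop) (by fun_prop), obsLaw]
  have h (t : Fin a.n) : gaussianReal (inner ℝ (a.x t) θ) 1
      = (gaussianReal 0 1).map (inner ℝ (a.x t) θ + ·) := by
    rw [gaussianReal_map_const_add, zero_add]
  simp_rw [h]
  rw [← Measure.pi_map_pi fun t => by fun_prop]
  rfl

lemma charFun_map_stdGaussian {E F : Type*} [NormedAddCommGroup E] [InnerProductSpace ℝ E]
    [FiniteDimensional ℝ E] [MeasurableSpace E] [BorelSpace E] [NormedAddCommGroup F]
    [InnerProductSpace ℝ F] [FiniteDimensional ℝ F] [MeasurableSpace F] [BorelSpace F]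
    (f : E →L[ℝ] F) (t : F) :
    charFun ((stdGaussian E).map f) t = Complex.exp (-‖f.adjoint t‖ ^ 2 / 2) := by
  rw [← charFun_stdGaussian, charFun_apply, charFun_apply, integral_map (by fun_prop)
    (Measurable.aestronglyMeasurable (by fun_prop))]
  simp_rw [ContinuousLinearMap.adjoint_inner_right]

/-- This is the covariance form of the error: `M* M = n A` and `A⁻¹ A A⁻¹ = A⁻¹` reduce it to `⟨t,
A⁻¹ t⟩ / n`. -/
lemma norm_adjoint_errorMap_sq (a : Allocation X) (hn : a.n ≠ 0) (t : Vec d) :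
    ‖(errorMap a).adjoint t‖ ^ 2 = (a.n : ℝ)⁻¹
      * ‖opOf (psdInvSqrt (designMatrix (empirical a))) t‖ ^ 2 := by
  have hn' : (a.n : ℝ) ≠ 0 := by exact_mod_cast hn
  set B := designMatrix (empirical a) with hB
  have h1 : (errorMap a).adjoint t
      = (a.n : ℝ)⁻¹ • measMap a (opOf (psdInv B) t) := by
    refine ext_inner_right ℝ fun ε => ?_
    rw [ContinuousLinearMap.adjoint_inner_left, errorMap, real_inner_smul_left,
      ← ContinuousLinearMap.adjoint_inner_right, inner_toEuclideanCLM_comm (isSelfAdjoint_psdInv _)]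
    simp [inner_smul_right, hB]
  rw [h1, norm_smul, mul_pow, ← real_inner_self_eq_norm_sq (measMap a _),
    ← ContinuousLinearMap.adjoint_inner_right, adjoint_measMap_measMap a hn, ← hB,
    inner_smul_right, inner_toEuclideanCLM_comm (isSelfAdjoint_psdInv _),
    ← mul_apply_eq_comp, ← mul_apply_eq_comp, ← map_mul, ← map_mul,
    ← mul_assoc, psdInv_mul_mul_psdInv (posSemidef_designMatrix_empirical a),
    norm_psdInvSqrt_sq (posSemidef_designMatrix_empirical a)]
  rw [norm_inv, Real.norm_natCast]
  field_simp

/-- The error of the least squares estimate has the law `N(0, A⁻¹ / n)`. -/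
lemma map_errorMap (a : Allocation X) (hn : a.n ≠ 0) :
    (stdGaussian (EuclideanSpace ℝ (Fin a.n))).map (errorMap a)
      = (stdGaussian (Vec d)).map ((√a.n)⁻¹ •
          opOf (psdInvSqrt (designMatrix (empirical a)))) := by
  have hS : IsSelfAdjoint (opOf (psdInvSqrt (designMatrix (empirical a)))) :=
    IsSelfAdjoint.map (isSelfAdjoint_psdInvSqrt _) _
  -- The image of a standard Gaussian under a linear `f` is determined by `t ↦ ‖f* t‖²`.
  refine Measure.ext_of_charFun ?_
  ext t
  rw [charFun_map_stdGaussian, charFun_map_stdGaussian]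
  have : ‖(errorMap a).adjoint t‖ ^ 2 = ‖((√a.n)⁻¹ •
      opOf (psdInvSqrt (designMatrix (empirical a)))).adjoint t‖ ^ 2 := by
    rw [norm_adjoint_errorMap_sq a hn]
    simp only [map_smulₛₗ, hS.adjoint_eq]
    simp [norm_smul, mul_pow]
  norm_cast
  rw [this]

end Allocation

/-! ### The two lower bounds on the number of samples -/

section LowerBound

variable {X Z : Set (Vec d)} {θ zs : Vec d}

lemma inner_sub_pos (h : argmaxSet Z θ = {zs}) {z : Vec d} (hz : z ∈ Z \ {zs}) :
    0 < inner ℝ θ (zs - z) := by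
  have hzs : zs ∈ argmaxSet Z θ := h ▸ rfl
  rw [inner_sub_right, sub_pos, real_inner_comm, real_inner_comm zs]
  refine lt_of_le_of_ne (hzs.2 z hz.1) fun heq => hz.2 ?_
  rw [← h]
  exact ⟨hz.1, fun w hw => heq ▸ hzs.2 w hw⟩

/-- The vector `A^{-1/2} (zs - z) / (√n ⟨θ, zs - z⟩)`, where `A` is the empirical design matrix:
the procedure prefers `zs` to `z` if `-1 < ⟨gapVec, η⟩`, where `η` is standard Gaussian. -/
def gapVec (a : Allocation X) (θ zs z : Vec d) : Vec d :=
  ((√a.n)⁻¹ * (inner ℝ θ (zs - z))⁻¹) • opOf (psdInvSqrt (designMatrix (empirical a))) (zs - z)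

lemma obsLaw_outputEvent_le (a : Allocation X) (hn : a.n ≠ 0) (h : argmaxSet Z θ = {zs}) :
    obsLaw a θ (outputEvent a Z zs)
      ≤ stdGaussian (Vec d) {η | ∀ z : ↥(Z \ {zs}), -1 ≤ inner ℝ (gapVec a θ zs z) η} := by
  set D : Set (Vec d) := {u | ∀ z : ↥(Z \ {zs}), 0 ≤ inner ℝ (zs - z) (θ + u)} with hD
  have hDc : IsClosed D := by
    simp only [hD, Set.ofPred_forall]
    exact isClosed_iInter fun z => isClosed_le continuous_const (by fun_prop)
  -- Weakening the output event to non-strict inequalities for one explicit estimate gives a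
  -- measurable superset.
  set C : Set (Fin a.n → ℝ) :=
    (fun y => errorMap a (WithLp.toLp 2 y - measMap a θ)) ⁻¹' D with hC
  have hCm : MeasurableSet C := hDc.measurableSet.preimage (by fun_prop)
  have hsub : outputEvent a Z zs ⊆ C := by
    intro y hy z
    have hmem := add_errorMap_mem_mleSet a hn θ (WithLp.toLp 2 y - measMap a θ)
    rw [add_sub_cancel] at hmem
    have hzs : zs ∈ argmaxSet Z (θ + errorMap a (WithLp.toLp 2 y - measMap a θ)) :=
      hy _ hmem ▸ rfl
    rw [inner_sub_left, sub_nonneg]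
    exact hzs.2 z z.2.1
  refine (measure_mono hsub).trans (le_of_eq ?_)
  rw [obsLaw_eq_map, Measure.map_apply (by fun_prop) hCm]
  have hpre : (fun ε => (measMap a θ + ε).ofLp) ⁻¹' C = errorMap a ⁻¹' D := by
    ext ε
    simp [hC]
  rw [hpre, ← Measure.map_apply (by fun_prop) hDc.measurableSet, map_errorMap a hn,
    Measure.map_apply (by fun_prop) hDc.measurableSet]
  congr 1
  ext η
  simp only [hD, Set.mem_preimage, Set.mem_ofPred_eq]
  refine forall_congr' fun z => ?_
  have hΔ := inner_sub_pos h z.2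
  have hval : inner ℝ (zs - z) (θ + ((√a.n)⁻¹ •
      opOf (psdInvSqrt (designMatrix (empirical a)))) η)
      = inner ℝ θ (zs - z) * (1 + inner ℝ (gapVec a θ zs z) η) := by
    rw [gapVec, real_inner_smul_left, inner_toEuclideanCLM_comm (isSelfAdjoint_psdInvSqrt _),
      inner_add_right, real_inner_comm, smul_apply, inner_smul_right]
    field_simp
  rw [hval, mul_nonneg_iff_of_pos_left hΔ]
  constructor <;> intro h <;> linarith

/-- The ratio for `z` equals `n ‖g_z‖²` with `g_z` the gap vector, so the one-dimensional tail bound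
applies to each `z` separately. -/
lemma rho_empirical_mul_log_le (a : Allocation X) (hn : a.n ≠ 0) (h : argmaxSet Z θ = {zs})
    (hrange : ∀ z ∈ Z,
      zs - z ∈ LinearMap.range (Matrix.toEuclideanLin (designMatrix (empirical a))))
    {δ : ℝ} (hδ : 0 < δ) (hδ' : δ < 1 / 8)
    (hg : ENNReal.ofReal (1 - δ)
      ≤ stdGaussian (Vec d) {η | ∀ z : ↥(Z \ {zs}), -1 ≤ inner ℝ (gapVec a θ zs z) η}) :
    rho Z θ zs (empirical a) * ENNReal.ofReal (Real.log (1 / δ)) ≤ 11 * (a.n : ℝ≥0∞) := by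
  simp only [rho, ENNReal.iSup_mul]
  refine iSup₂_le fun z hz => ?_
  have hΔ := inner_sub_pos h hz
  have hn' : 0 < (a.n : ℝ) := by positivity
  rw [invNormSq, if_pos (hrange z hz.1), ← ENNReal.ofReal_div_of_pos (by positivity),
    ← ENNReal.ofReal_mul' (Real.log_nonneg (by rw [le_div_iff₀ hδ]; linarith)),
    show (11 * (a.n : ℝ≥0∞)) = ENNReal.ofReal (11 * a.n) by simp [ENNReal.ofReal_mul]]
  refine ENNReal.ofReal_le_ofReal ?_
  have key := norm_sq_mul_log_le (gapVec a θ zs z) hδ hδ'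
    (hg.trans (measure_mono fun η hη => hη ⟨z, hz⟩))
  have hnorm : inner ℝ (zs - z) (Matrix.toEuclideanLin (psdInv (designMatrix (empirical a)))
      (zs - z)) / inner ℝ θ (zs - z) ^ 2 = a.n * ‖gapVec a θ zs z‖ ^ 2 := by
    have h1 := norm_psdInvSqrt_sq (posSemidef_designMatrix_empirical a) (zs - z)
    rw [gapVec, norm_smul, mul_pow, h1, ← Matrix.coe_toEuclideanCLM_eq_toEuclideanLin,
      Real.norm_eq_abs, sq_abs, mul_pow, inv_pow, Real.sq_sqrt hn'.le]
    simp only [ContinuousLinearMap.coe_coe]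
    field_simp
  rw [hnorm, mul_assoc]
  nlinarith

lemma gamma_empirical_le (a : Allocation X) (hn : a.n ≠ 0)
    (hrange : ∀ z ∈ Z,
      zs - z ∈ LinearMap.range (Matrix.toEuclideanLin (designMatrix (empirical a))))
    (hg : 7 / 8
      ≤ stdGaussian (Vec d) {η | ∀ z : ↥(Z \ {zs}), -1 ≤ inner ℝ (gapVec a θ zs z) η}) :
    gamma Z θ zs (empirical a) ≤ 25 * (a.n : ℝ≥0∞) := by
  have hn' : 0 < √(a.n : ℝ) := by positivity
  have hwidth : gaussWidth Z θ zs (empirical a) ≤ ENNReal.ofReal √a.n * 5 := by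
    -- Only the positive part is needed: the supremum is `√n` times that of `⟨g_z, η⟩`, hence at
    -- most `√n` times that of the absolute values.
    refine tsub_le_self.trans ?_
    have h5 := lintegral_iSup_enorm_inner_le _ (measure_slab_ge_of_one_sided _ hg)
    refine le_trans ?_ (mul_le_mul_right h5 _)
    rw [← lintegral_const_mul' _ _ ENNReal.ofReal_ne_top]
    refine lintegral_mono fun η => ?_
    set R := ENNReal.ofReal √a.n
      * ⨆ z : ↥(Z \ {zs}), ‖inner ℝ (gapVec a θ zs z) η‖ₑ with hR
    rw [← EReal.toENNReal_coe (x := R)]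
    refine EReal.toENNReal_le_toENNReal (iSup₂_le fun z hz => ?_)
    have hval : inner ℝ (zs - z)
        (Matrix.toEuclideanLin (psdInvSqrt (designMatrix (empirical a))) η) / inner ℝ θ (zs - z)
        = √a.n * inner ℝ (gapVec a θ zs z) η := by
      rw [gapVec, real_inner_smul_left, inner_toEuclideanCLM_comm (isSelfAdjoint_psdInvSqrt _),
        ← Matrix.coe_toEuclideanCLM_eq_toEuclideanLin]
      simp only [ContinuousLinearMap.coe_coe]
      field_simp
    have hle : ENNReal.ofReal (√a.n * inner ℝ (gapVec a θ zs z) η) ≤ R := by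
      rw [ENNReal.ofReal_mul hn'.le, hR]
      gcongr
      refine le_trans ?_ (le_iSup (fun z : ↥(Z \ {zs}) => ‖inner ℝ (gapVec a θ zs z) η‖ₑ) ⟨z, hz⟩)
      rw [← ofReal_norm]
      exact ENNReal.ofReal_le_ofReal (le_abs_self _)
    rw [hval]
    refine le_trans ?_ (EReal.coe_ennreal_le_coe_ennreal_iff.2 hle)
    rw [EReal.coe_ennreal_ofReal]
    exact EReal.coe_le_coe_iff.2 (le_max_left _ _)
  rw [gamma, if_pos hrange]
  calc gaussWidth Z θ zs (empirical a) ^ 2 ≤ (ENNReal.ofReal √a.n * 5) ^ 2 := by gcongr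
    _ = 25 * (a.n : ℝ≥0∞) := by
      rw [mul_pow, ← ENNReal.ofReal_pow hn'.le, Real.sq_sqrt (by positivity),
        ENNReal.ofReal_natCast, mul_comm]
      norm_num

lemma single_mem_designs {x : Vec d} (hx : x ∈ X) : Finsupp.single x 1 ∈ designs X := by
  simpa [empirical] using
    empirical_mem_designs (X := X) ⟨1, fun _ => x, fun _ => hx⟩ one_ne_zero

lemma rhoStar_singleton (hX : X.Nonempty) : rhoStar X {zs} θ zs = 0 := by
  obtain ⟨x, hx⟩ := hX
  exact nonpos_iff_eq_zero.1 (iInf₂_le_of_le _ (single_mem_designs hx) (by simp [rho]))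

lemma gammaStar_singleton (hX : X.Nonempty) : gammaStar X {zs} θ zs = 0 := by
  obtain ⟨x, hx⟩ := hX
  refine nonpos_iff_eq_zero.1 (iInf₂_le_of_le _ (single_mem_designs hx) ?_)
  rw [gamma, if_pos fun z hz => by
    rw [Set.mem_singleton_iff.1 hz, sub_self]
    exact zero_mem _]
  simp [gaussWidth, gaussSup]

/-- Without any measurement, the procedure has an output only if there is a single item. -/
lemma eq_singleton_of_mem_outputEvent (a : Allocation X) (hn : a.n = 0) {y : Fin a.n → ℝ}
    (hy : y ∈ outputEvent a Z zs) : Z = {zs} := by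
  have : IsEmpty (Fin a.n) := by rw [hn]; infer_instance
  rw [← hy 0 (fun θ' => by simp)]
  ext z
  simp [argmaxSet]

end LowerBound

end TransductiveBandit

end

theorem theorem2 :
    ∃ c : ℝ, 0 < c ∧
      ∀ (d : ℕ) (X Z : Set (TransductiveBandit.Vec d)) (_ : X.Nonempty)
        (δ : ℝ) (_ : 0 < δ) (_ : δ < 1 / 8)
        (alloc : TransductiveBandit.Vec d → TransductiveBandit.Allocation X)
        (_ : TransductiveBandit.IsPAC δ X Z Set.univ alloc)
        (θ zs : TransductiveBandit.Vec d)
        (_ : TransductiveBandit.argmaxSet Z θ = {zs}),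
        ENNReal.ofReal c *
            (TransductiveBandit.gammaStar X Z θ zs
              + TransductiveBandit.rhoStar X Z θ zs * ENNReal.ofReal (Real.log (1 / δ)))
          ≤ ((alloc θ).n : ENNReal) := by
  -- `36 = 25 + 11`, from the `γ` and `ρ` bounds.
  refine ⟨1 / 36, by norm_num, ?_⟩
  intro d X Z hX δ hδ hδ' alloc hpac θ zs hzs
  have hP := hpac θ (Set.mem_univ _) zs hzs
  set a := alloc θ
  -- A single successful observation already yields the range condition, which depends only on the
  -- design.
  obtain ⟨y, hy⟩ : (TransductiveBandit.outputEvent a Z zs).Nonempty := by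
    refine nonempty_of_measure_ne_zero (μ := TransductiveBandit.obsLaw a θ) fun h0 => ?_
    rw [h0, nonpos_iff_eq_zero, ENNReal.ofReal_eq_zero] at hP
    linarith
  by_cases hn : a.n = 0
  · obtain rfl := TransductiveBandit.eq_singleton_of_mem_outputEvent a hn hy
    simp [TransductiveBandit.rhoStar_singleton hX, TransductiveBandit.gammaStar_singleton hX]
  have hrange := fun z hz =>
    TransductiveBandit.sub_mem_range_of_mem_outputEvent a hn hy (z := z) hz
  have hg := hP.trans (TransductiveBandit.obsLaw_outputEvent_le a hn hzs)
  have h78 : (7 / 8 : ENNReal) ≤ ENNReal.ofReal (1 - δ) := by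
    rw [← ENNReal.ofReal_toReal (a := 7 / 8) (by finiteness)]
    refine ENNReal.ofReal_le_ofReal ?_
    norm_num
    linarith
  have hw := TransductiveBandit.empirical_mem_designs a hn
  have hγ : TransductiveBandit.gammaStar X Z θ zs ≤ 25 * (a.n : ENNReal) :=
    (iInf₂_le _ hw).trans (TransductiveBandit.gamma_empirical_le a hn hrange (h78.trans hg))
  have hρ : TransductiveBandit.rhoStar X Z θ zs * ENNReal.ofReal (Real.log (1 / δ))
      ≤ 11 * (a.n : ENNReal) :=
    (mul_le_mul_left (iInf₂_le _ hw) _).trans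
      (TransductiveBandit.rho_empirical_mul_log_le a hn hzs hrange hδ hδ' hg)
  calc _ ≤ ENNReal.ofReal (1 / 36) * (25 * (a.n : ENNReal) + 11 * (a.n : ENNReal)) := by gcongr
    _ = ENNReal.ofReal (1 / 36) * ENNReal.ofReal 36 * (a.n : ENNReal) := by
      rw [← add_mul, mul_assoc]
      norm_num
    _ = (a.n : ENNReal) := by
      rw [← ENNReal.ofReal_mul (by norm_num)]
      norm_num
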